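/- Let formulas be built from a denumerable set of propositional variables with the connectives $\wedge,\vee,\to,\neg$, and let $\mathcal R$ be the relevant logic (without propositional constants) given by all instances of the axioms $\alpha\to\alpha$; $(\alpha\to\beta)\to((\beta\to\gamma)\to(\alpha\to\gamma))$; $\alpha\to((\alpha\to\beta)\to\beta)$; $(\alpha\to(\alpha\to\beta))\to(\alpha\to\beta)$; $\alpha\wedge\beta\to\alpha$; $\alpha\wedge\beta\to\beta$; $((\alpha\to\beta)\wedge(\alpha\to\gamma))\to(\alpha\to\beta\wedge\gamma)$; $\alpha\to\alpha\vee\beta$; $\beta\to\alpha\vee\beta$; $((\alpha\to\gamma)\wedge(\beta\to\gamma))\to(\alpha\vee\beta\to\gamma)$; $\alpha\wedge(\beta\vee\gamma)\to(\alpha\wedge\beta)\vee(\alpha\wedge\gamma)$; $(\alpha\to\neg\beta)\to(\beta\to\neg\alpha)$; $\neg\neg\alpha\to\alpha$, together with the rules modus ponens (from $\alpha\to\beta$ and $\alpha$ infer $\beta$) and adjunction (from $\alpha$ and $\beta$ infer $\alpha\wedge\beta$). The crystal lattice $\mathbf C$ is the algebra on $\{\bot,\mathrm t,a,b,\mathrm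 f,\top\}$ whose $\wedge,\vee$ are those of the lattice order $\bot<\mathrm t<a,b<\mathrm f<\top$ (with $a,b$ incomparable), with $\neg\top=\bot$, $\neg\bot=\top$, $\neg\mathrm f=\mathrm t$, $\neg\mathrm t=\mathrm f$, $\neg a=a$, $\neg b=b$, and $x\to y=\neg(x\cdot\neg y)$, where $\cdot$ is the commutative operation for which $\bot$ is absorbing, $\mathrm t$ is a unit, $a\cdot a=a$, $b\cdot b=b$, and all remaining products are $\top$. Let $\mathsf C$ be the variety generated by $\mathbf C$. A formula $\varphi$ is valid in $\mathsf C$ if the equation $\varphi\wedge(\varphi\to\varphi)\approx\varphi\to\varphi$ holds in all members of $\mathsf C$. Let $\mathcal C$ be the schematic extension of $\mathcal R$ corresponding to $\mathsf C$, that is, $\mathcal R$ with all formulas valid in $\mathsf C$ added as axiom schemata. Write $\Gamma\vdash\alpha$ if $\alpha$ is derivable in $\mathcal C$ from the set of formulas $\Gamma$, and let $\mathsf{var}(\cdot)$ denote the set of variables occurring in a formula or a set of formulas. **Theorem.** The logic $\mathcal C$ has the following properties. 1. (Variable sharing property) If $\vdash\alpha\to\beta$, then $\mathsf{var}(\alpha)\cap\mathsf{var}(\beta)\neq\emptyset$.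 2. (Maehara interpolation property) For all sets of formulas $\Sigma,\Gamma$ and every formula $\alpha$: if $\mathsf{var}(\Sigma\cup\{\alpha\})\cap\mathsf{var}(\Gamma)\neq\emptyset$ and $\Sigma,\Gamma\vdash\alpha$, then there is a formula $\delta$ with $\mathsf{var}(\delta)\subseteq\mathsf{var}(\Sigma\cup\{\alpha\})\cap\mathsf{var}(\Gamma)$ such that $\Gamma\vdash\delta$ and $\Sigma,\delta\vdash\alpha$. In particular, $\mathcal C$ has the deductive interpolation property: if $\mathsf{var}(\alpha)\cap\mathsf{var}(\Gamma)\neq\emptyset$ and $\Gamma\vdash\alpha$, then there is a formula $\delta$ with $\mathsf{var}(\delta)\subseteq\mathsf{var}(\alpha)\cap\mathsf{var}(\Gamma)$ such that $\Gamma\vdash\delta$ and $\delta\vdash\alpha$. -/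

import Mathlib

namespace RelevantLogic

/-- Formulas of the language `∧, ∨, →, ¬` (no propositional constants) over the denumerable set `ℕ`
of propositional variables. Fusion is definable as `¬(α → ¬β)`. -/
inductive Formula : Type where
  | var : ℕ → Formula
  | and : Formula → Formula → Formula
  | or : Formula → Formula → Formula
  | imp : Formula → Formula → Formula
  | neg : Formula → Formula

namespace Formula

/-- The set of variables occurring in a formula. -/
def vars : Formula → Set ℕ
  | var p => {p}
  | and φ ψ => vars φ ∪ vars ψ
  | or φ ψ => vars φ ∪ vars ψ
  | imp φ ψ => vars φ ∪ vars ψ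
  | neg φ => vars φ

/-- Uniform substitution. -/
def subst (σ : ℕ → Formula) : Formula → Formula
  | var p => σ p
  | and φ ψ => and (subst σ φ) (subst σ ψ)
  | or φ ψ => or (subst σ φ) (subst σ ψ)
  | imp φ ψ => imp (subst σ φ) (subst σ ψ)
  | neg φ => neg (subst σ φ)

end Formula

/-- The set of variables occurring in a set of formulas. -/
def varsSet (G : Set Formula) : Set ℕ := {p | ∃ φ ∈ G, p ∈ φ.vars}

/-- Axioms of the relevant logic `R` (without propositional constants). -/
inductive AxiomR : Formula → Prop where
  | identity (α : Formula) : AxiomR (.imp α α)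
  | suffixing (α β γ : Formula) :
      AxiomR (.imp (.imp α β) (.imp (.imp β γ) (.imp α γ)))
  | assertion (α β : Formula) : AxiomR (.imp α (.imp (.imp α β) β))
  | contraction (α β : Formula) : AxiomR (.imp (.imp α (.imp α β)) (.imp α β))
  | and_left (α β : Formula) : AxiomR (.imp (.and α β) α)
  | and_right (α β : Formula) : AxiomR (.imp (.and α β) β)
  | and_intro (α β γ : Formula) :
      AxiomR (.imp (.and (.imp α β) (.imp α γ)) (.imp α (.and β γ)))
  | or_left (α β : Formula) : AxiomR (.imp α (.or α β))
  | or_right (α β : Formula) : AxiomR (.imp β (.or α β))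
  | or_elim (α β γ : Formula) :
      AxiomR (.imp (.and (.imp α γ) (.imp β γ)) (.imp (.or α β) γ))
  | distribution (α β γ : Formula) :
      AxiomR (.imp (.and α (.or β γ)) (.or (.and α β) (.and α γ)))
  | contraposition (α β : Formula) :
      AxiomR (.imp (.imp α (.neg β)) (.imp β (.neg α)))
  | double_neg (α : Formula) : AxiomR (.imp (.neg (.neg α)) α)

/-- Deducibility `G ⊢ φ` in the schematic extension of `R` by the schemata in `Ax`: finite
derivations from `G`, the axioms of `R` and all substitution instances of members of `Ax`, by
modus ponens and adjunction. With `Ax = ∅` this is `R` itself. -/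
inductive SchematicExtension (Ax : Set Formula) (G : Set Formula) : Formula → Prop where
  | hyp {φ : Formula} : φ ∈ G → SchematicExtension Ax G φ
  | axR {φ : Formula} : AxiomR φ → SchematicExtension Ax G φ
  | schema {φ : Formula} (σ : ℕ → Formula) : φ ∈ Ax → SchematicExtension Ax G (φ.subst σ)
  | mp {φ ψ : Formula} : SchematicExtension Ax G (.imp φ ψ) → SchematicExtension Ax G φ →
      SchematicExtension Ax G ψ
  | adj {φ ψ : Formula} : SchematicExtension Ax G φ → SchematicExtension Ax G ψ →
      SchematicExtension Ax G (.and φ ψ)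

/-- Algebras in the similarity type `∧, ∨, →, ¬`. -/
structure Alg : Type 1 where
  carrier : Type
  nonempty : Nonempty carrier
  meet : carrier → carrier → carrier
  join : carrier → carrier → carrier
  imp : carrier → carrier → carrier
  neg : carrier → carrier

/-- Homomorphisms of such algebras. -/
structure IsHom (A B : Alg) (f : A.carrier → B.carrier) : Prop where
  map_meet : ∀ x y, f (A.meet x y) = B.meet (f x) (f y)
  map_join : ∀ x y, f (A.join x y) = B.join (f x) (f y)
  map_imp : ∀ x y, f (A.imp x y) = B.imp (f x) (f y)
  map_neg : ∀ x, f (A.neg x) = B.neg (f x)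

/-- Direct products. -/
def Alg.pi {I : Type} (F : I → Alg) : Alg where
  carrier := ∀ i, (F i).carrier
  nonempty := ⟨fun i => Classical.choice (F i).nonempty⟩
  meet x y := fun i => (F i).meet (x i) (y i)
  join x y := fun i => (F i).join (x i) (y i)
  imp x y := fun i => (F i).imp (x i) (y i)
  neg x := fun i => (F i).neg (x i)

/-- A variety: a class of algebras closed under homomorphic images, (isomorphic copies of)
subalgebras and direct products. -/
structure IsVariety (W : Set Alg) : Prop where
  image : ∀ (A B : Alg) (f : A.carrier → B.carrier),
    IsHom A B f → Function.Surjective f → A ∈ W → B ∈ W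
  sub : ∀ (A B : Alg) (f : A.carrier → B.carrier),
    IsHom A B f → Function.Injective f → B ∈ W → A ∈ W
  prod : ∀ (I : Type) (F : I → Alg), (∀ i, F i ∈ W) → Alg.pi F ∈ W

/-- The variety generated by a class `K`: the smallest variety containing `K`. -/
def generatedVariety (K : Set Alg) : Set Alg :=
  {A | ∀ W : Set Alg, IsVariety W → K ⊆ W → A ∈ W}

/-- The value of a formula under an assignment. -/
def Alg.eval (A : Alg) (v : ℕ → A.carrier) : Formula → A.carrier
  | .var p => v p
  | .and φ ψ => A.meet (A.eval v φ) (A.eval v ψ)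
  | .or φ ψ => A.join (A.eval v φ) (A.eval v ψ)
  | .imp φ ψ => A.imp (A.eval v φ) (A.eval v ψ)
  | .neg φ => A.neg (A.eval v φ)

/-- `x` is designated if `x → x ≤ x`. This is the defining equation
`x ∧ (x → x) ≈ x → x` of the algebraization of `R` by relevant algebras. -/
def Alg.Designated (A : Alg) (x : A.carrier) : Prop :=
  A.meet x (A.imp x x) = A.imp x x

/-- `φ` is valid in `A` if it is designated under all assignments. -/
def Alg.Valid (A : Alg) (φ : Formula) : Prop :=
  ∀ v : ℕ → A.carrier, A.Designated (A.eval v φ)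

/-- The schematic extension of `R` corresponding to a variety `W`: all formulas valid in `W` are
added to `R` as axiom schemata. -/
def logicOf (W : Set Alg) : Set Formula → Formula → Prop :=
  SchematicExtension {φ | ∀ A ∈ W, A.Valid φ}

/-- The elements of the crystal lattice, `⊥ < t < a, b < f < ⊤` with `a, b` incomparable. -/
inductive Crystal : Type where
  | bot | t | a | b | f | top
  deriving DecidableEq

namespace Crystal

/-- Meet for the order `⊥ < t < a, b < f < ⊤`. -/
def meet : Crystal → Crystal → Crystal
  | top, y => y
  | x, top => x
  | bot, _ => bot
  | _, bot => bot
  | f, y => y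
  | x, f => x
  | t, _ => t
  | _, t => t
  | a, a => a
  | b, b => b
  | a, b => t
  | b, a => t

/-- Join for the order `⊥ < t < a, b < f < ⊤`. -/
def join : Crystal → Crystal → Crystal
  | bot, y => y
  | x, bot => x
  | top, _ => top
  | _, top => top
  | t, y => y
  | x, t => x
  | f, _ => f
  | _, f => f
  | a, a => a
  | b, b => b
  | a, b => f
  | b, a => f

/-- Negation: `¬⊤ = ⊥`, `¬f = t`, `¬a = a`, `¬b = b`. -/
def neg : Crystal → Crystal
  | bot => top
  | t => f
  | a => a
  | b => b
  | f => t
  | top => bot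

/-- Fusion: `⊥` is absorbing, `t` is the unit, `a² = a`, `b² = b`, and all other products
(such as `ab` and `f²`) are `⊤`. -/
def mul : Crystal → Crystal → Crystal
  | bot, _ => bot
  | _, bot => bot
  | t, y => y
  | x, t => x
  | a, a => a
  | b, b => b
  | _, _ => top

/-- `x → y = ¬(x · ¬y)`. -/
def imp (x y : Crystal) : Crystal := neg (mul x (neg y))

end Crystal

/-- The crystal lattice as an algebra. -/
def crystal : Alg where
  carrier := Crystal
  nonempty := ⟨Crystal.t⟩
  meet := Crystal.meet
  join := Crystal.join
  imp := Crystal.imp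
  neg := Crystal.neg

/-- Deducibility in the logic of the crystal lattice: the schematic extension of `R` corresponding
to the variety generated by the crystal lattice. -/
def logicC : Set Formula → Formula → Prop := logicOf (generatedVariety {crystal})

/-- The variable sharing property. -/
def VariableSharing (L : Set Formula → Formula → Prop) : Prop :=
  ∀ α β : Formula, L ∅ (.imp α β) → (α.vars ∩ β.vars).Nonempty

/-- The Maehara interpolation property. -/
def MaeharaInterpolation (L : Set Formula → Formula → Prop) : Prop :=
  ∀ (S G : Set Formula) (α : Formula),
    (varsSet (S ∪ {α}) ∩ varsSet G).Nonempty → L (S ∪ G) α →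
      ∃ δ : Formula, δ.vars ⊆ varsSet (S ∪ {α}) ∩ varsSet G ∧ L G δ ∧ L (S ∪ {δ}) α

/-- The deductive interpolation property. -/
def DeductiveInterpolation (L : Set Formula → Formula → Prop) : Prop :=
  ∀ (G : Set Formula) (α : Formula),
    (α.vars ∩ varsSet G).Nonempty → L G α →
      ∃ δ : Formula, δ.vars ⊆ α.vars ∩ varsSet G ∧ L G δ ∧ L {δ} α

end RelevantLogic

namespace RelevantLogic

/-! ### Subalgebras of the square of the crystal lattice that preserve designation. -/

namespace Crystal

/-! The logic is finitary, and on finite premise sets it coincides with `Entails`: truth in the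
crystal lattice with only `⊥` undesignated. Both properties then become statements about
assignments.

Variable sharing holds because `{a}` and `{b}` are subalgebras and `a → b = ⊥`.

For interpolation, compare assignments `v` satisfying the premises `G` with assignments `w`
satisfying `S` but refuting `α`. The pairs of values that `v` and `w` give to formulas over `Z` form
a subalgebra of the square. If no such formula is designated at `v` and undesignated at `w`,
`rel_cases` makes `w` on `Z` equal to `v`, its image under `swap`, or a constant `a` or `b`. Each of
these extends to an assignment still satisfying `G`, and gluing it to `w` refutes the entailment.
Hence every such pair is separated by a formula over `Z`. For finite `Z` only finitely many
restrictions matter, so a disjunction of conjunctions of separating formulas is an interpolant. -/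

instance : Fintype Crystal where
  elems := {bot, t, a, b, f, top}
  complete x := by cases x <;> decide

/-- The automorphism exchanging `a` and `b`. -/
def swap : Crystal → Crystal
  | a => b
  | b => a
  | x => x

set_option synthInstance.maxSize 1000 in
set_option synthInstance.maxHeartbeats 200000 in
/-- A binary relation closed under the operations of the crystal lattice and preserving
designation is contained in the graph of an automorphism or has constant second projection `a`
or `b`. -/
theorem rel_cases {S : Crystal → Crystal → Prop}
    (hmeet : ∀ {x y x' y'}, S x y → S x' y' → S (meet x x') (meet y y'))
    (himp : ∀ {x y x' y'}, S x y → S x' y' → S (imp x x') (imp y y'))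
    (hneg : ∀ {x y}, S x y → S (neg x) (neg y))
    (hD : ∀ {x y}, S x y → x ≠ bot → y ≠ bot) :
    (∀ x y, S x y → y = x) ∨ (∀ x y, S x y → y = swap x) ∨
      (∀ x y, S x y → y = a) ∨ (∀ x y, S x y → y = b) := by
  -- `x → y ≠ ⊥` holds exactly when `x ≤ y`. Since `x → x` is designated, `y ≤ y'` and `y' ≤ y`.
  have hfun : ∀ {x y y'}, S x y → S x y' → y = y' := by
    intro x y y' h h'
    have h1 := hD (himp h h')
    have h2 := hD (himp h' h)
    revert h1 h2
    clear h h'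
    revert x y y'
    decide
  -- The five unary terms tested here form a designation pattern that identifies `x` from any `y`
  -- outside `{a, b}`.
  have hone : ∀ {x y}, S x y → y = x ∨ y = a ∨ y = b := by
    intro x y h
    have h1 := hD h
    have h2 := hD (hneg h)
    have h3 := hD (himp h (hneg h))
    have h4 := hD (himp (hneg h) h)
    have h5 := hD (himp (hneg (himp h h)) (himp h h))
    revert h1 h2 h3 h4 h5
    clear h
    revert x y
    decide
  by_cases ha : ∀ x y, S x y → y = a
  · exact .inr (.inr (.inl ha))
  by_cases hb : ∀ x y, S x y → y = b
  · exact .inr (.inr (.inr hb))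
  push Not at ha hb
  obtain ⟨x₁, y₁, hS₁, hy₁⟩ := ha
  obtain ⟨x₂, y₂, hS₂, hy₂⟩ := hb
  obtain ⟨x, hx, hxa, hxb⟩ : ∃ x, S x x ∧ x ≠ a ∧ x ≠ b := by
    have key : ∃ x y, S x y ∧ y ≠ a ∧ y ≠ b := by
      by_cases h₁ : y₁ = b
      · by_cases h₂ : y₂ = a
        · refine ⟨_, _, hmeet hS₁ hS₂, ?_⟩
          subst h₁ h₂
          decide
        · exact ⟨_, _, hS₂, h₂, hy₂⟩
      · exact ⟨_, _, hS₁, hy₁, h₁⟩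
    obtain ⟨x, y, h, hya, hyb⟩ := key
    rcases hone h with rfl | h' | h'
    · exact ⟨_, h, hya, hyb⟩
    · exact absurd h' hya
    · exact absurd h' hyb
  have hbot : S bot bot := by
    -- This term takes the value `⊥` at every element except the fixed points `a`, `b` of negation.
    have h := hmeet (hmeet hx (hneg hx)) (hmeet (himp hx (hneg hx)) (himp (hneg hx) hx))
    have e : meet (meet x (neg x)) (meet (imp x (neg x)) (imp (neg x) x)) = bot := by
      revert hxa hxb
      clear h hx
      revert x
      decide
    rwa [e] at h
  have htop : S top top := hneg hbot
  have htwo : ∀ {x y}, S x y → y = x ∨ y = swap x := by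
    intro x y h
    have h1 := hone h
    have h2 : x = bot → y = bot := by rintro rfl; exact hfun h hbot
    have h3 : x = top → y = top := by rintro rfl; exact hfun h htop
    have h4 : imp x (neg x) = bot → imp y (neg y) = bot := by
      intro e
      have := himp h (hneg h)
      rw [e] at this
      exact hfun this hbot
    have h5 : imp (neg x) x = bot → imp (neg y) y = bot := by
      intro e
      have := himp (hneg h) h
      rw [e] at this
      exact hfun this hbot
    revert h1 h2 h3 h4 h5
    clear h
    revert x y
    decide
  by_cases hid : ∀ x y, S x y → y = x
  · exact .inl hid
  -- One exchanged pair forces the exchange everywhere: fixing the other of `a`, `b` would pair `a ∧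
  -- b = t` with `a` or `b`, contradicting `htwo`.
  refine .inr (.inl fun x' y' h' => ?_)
  push Not at hid
  obtain ⟨x, y, h, hne⟩ := hid
  have h1 := htwo h
  have h2 := htwo h'
  have h3 := htwo (hmeet h h')
  have h4 : x' = x → y' = y := by rintro rfl; exact hfun h' h
  revert hne h1 h2 h3 h4
  clear h h'
  revert x y x' y'
  decide

end Crystal

open Crystal

/-! ### Soundness and finite completeness over the crystal lattice. -/

theorem crystal_designated_iff (x : Crystal) : crystal.Designated x ↔ x ≠ bot := by
  change Crystal.meet x (Crystal.imp x x) = Crystal.imp x x ↔ x ≠ bot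
  revert x
  decide

theorem Alg.eval_congr (A : Alg) {v w : ℕ → A.carrier} {φ : Formula}
    (h : ∀ p ∈ φ.vars, v p = w p) : A.eval v φ = A.eval w φ := by
  induction φ with
  | var p => exact h p rfl
  | and φ ψ ih₁ ih₂ | or φ ψ ih₁ ih₂ | imp φ ψ ih₁ ih₂ =>
    simp only [Alg.eval, ih₁ fun p hp => h p (.inl hp), ih₂ fun p hp => h p (.inr hp)]
  | neg φ ih => simp only [Alg.eval, ih h]

theorem Alg.eval_subst (A : Alg) (v : ℕ → A.carrier) (σ : ℕ → Formula) (φ : Formula) :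
    A.eval v (φ.subst σ) = A.eval (fun p => A.eval v (σ p)) φ := by
  induction φ <;> simp_all [Alg.eval, Formula.subst]

theorem Formula.subst_var (φ : Formula) : φ.subst Formula.var = φ := by
  induction φ <;> simp_all [Formula.subst]

theorem IsHom.map_eval {A B : Alg} {g : A.carrier → B.carrier} (hg : IsHom A B g)
    (v : ℕ → A.carrier) (φ : Formula) : g (A.eval v φ) = B.eval (fun p => g (v p)) φ := by
  induction φ <;> simp_all [Alg.eval, hg.map_meet, hg.map_join, hg.map_imp, hg.map_neg]

theorem isHom_proj {I : Type} (F : I → Alg) (i : I) :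
    IsHom (Alg.pi F) (F i) (fun x => x i) :=
  ⟨fun _ _ => rfl, fun _ _ => rfl, fun _ _ => rfl, fun _ => rfl⟩

theorem IsHom.map_designated {A B : Alg} {g : A.carrier → B.carrier} (hg : IsHom A B g)
    {x : A.carrier} (h : A.Designated x) : B.Designated (g x) := by
  unfold Alg.Designated at *
  rw [← hg.map_imp, ← hg.map_meet, h]

/-- Validity is an equation, hence inherited by images, subalgebras and products; this reduces the
generated variety to its generator. -/
theorem isVariety_valid (φ : Formula) : IsVariety {A | A.Valid φ} where
  image A B g hg hsurj hA v := by
    obtain ⟨r, hr⟩ := hsurj.hasRightInverse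
    have h := hg.map_designated (hA fun p => r (v p))
    rw [hg.map_eval] at h
    simpa only [hr _] using h
  sub A B g hg hinj hB v := by
    apply hinj
    rw [hg.map_meet, hg.map_imp, hg.map_eval]
    exact hB _
  prod I F hF v := by
    funext i
    have h := hF i fun p => v p i
    rw [← (isHom_proj F i).map_eval v φ] at h
    exact h

theorem valid_generatedVariety_crystal {φ : Formula} :
    (∀ A ∈ generatedVariety {crystal}, A.Valid φ) ↔ crystal.Valid φ := by
  refine ⟨fun h => h _ fun W _ hW => hW rfl, fun h A hA => ?_⟩
  refine hA {A | A.Valid φ} (isVariety_valid φ) ?_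
  rintro _ rfl
  exact h

/-- The value of a formula in the crystal lattice. -/
abbrev val (v : ℕ → Crystal) (φ : Formula) : Crystal := crystal.eval v φ

/-- Consequence over the crystal lattice with every element but `⊥` designated. -/
def Entails (G : Set Formula) (φ : Formula) : Prop :=
  ∀ v : ℕ → Crystal, (∀ γ ∈ G, val v γ ≠ bot) → val v φ ≠ bot

theorem crystal_valid_iff {φ : Formula} : crystal.Valid φ ↔ ∀ v, val v φ ≠ bot :=
  forall_congr' fun _ => crystal_designated_iff _

theorem AxiomR.val_ne_bot {φ : Formula} (h : AxiomR φ) (v : ℕ → Crystal) : val v φ ≠ bot := by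
  cases h with
  | identity α =>
    change imp _ _ ≠ bot
    generalize crystal.eval v α = x
    change Crystal at x
    revert x
    decide
  | suffixing α β γ | and_intro α β γ | or_elim α β γ | distribution α β γ =>
    simp only [val, Alg.eval]
    generalize crystal.eval v α = x
    generalize crystal.eval v β = y
    generalize crystal.eval v γ = z
    change Crystal at x y z
    simp only [crystal]
    revert x y z
    decide
  | assertion α β | contraction α β | and_left α β | and_right α β | or_left α β
  | or_right α β | contraposition α β =>
    simp only [val, Alg.eval]
    generalize crystal.eval v α = x
    generalize crystal.eval v β = y
    change Crystal at x y
    simp only [crystal]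
    revert x y
    decide
  | double_neg α =>
    simp only [val, Alg.eval]
    generalize crystal.eval v α = x
    change Crystal at x
    simp only [crystal]
    revert x
    decide

theorem meet_ne_bot : ∀ {x y : Crystal}, Crystal.meet x y ≠ bot ↔ x ≠ bot ∧ y ≠ bot := by
  decide

theorem join_ne_bot : ∀ {x y : Crystal}, Crystal.join x y ≠ bot ↔ x ≠ bot ∨ y ≠ bot := by
  decide

theorem imp_ne_bot_mp : ∀ {x y : Crystal}, Crystal.imp x y ≠ bot → x ≠ bot → y ≠ bot := by
  decide

theorem imp_self_ne_bot : ∀ x : Crystal, Crystal.imp x x ≠ bot := by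
  decide

/-- Soundness, together with finitarity. -/
theorem exists_finite_entails {G : Set Formula} {φ : Formula} (h : logicC G φ) :
    ∃ F ⊆ G, F.Finite ∧ Entails F φ := by
  induction h with
  | @hyp φ h => exact ⟨{φ}, by simpa using h, Set.finite_singleton _, fun v hv => hv φ rfl⟩
  | axR h => exact ⟨∅, Set.empty_subset _, Set.finite_empty, fun v _ => h.val_ne_bot v⟩
  | schema σ h =>
    refine ⟨∅, Set.empty_subset _, Set.finite_empty, fun v _ => ?_⟩
    have hval := crystal_valid_iff.1 (valid_generatedVariety_crystal.1 h)
      fun p => crystal.eval v (σ p)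
    exact fun e => hval ((crystal.eval_subst v σ _).symm.trans e)
  | mp _ _ ih₁ ih₂ =>
    obtain ⟨F₁, hs₁, hf₁, h₁⟩ := ih₁
    obtain ⟨F₂, hs₂, hf₂, h₂⟩ := ih₂
    exact ⟨F₁ ∪ F₂, Set.union_subset hs₁ hs₂, hf₁.union hf₂, fun v hv =>
      imp_ne_bot_mp (h₁ v fun γ hγ => hv γ (.inl hγ)) (h₂ v fun γ hγ => hv γ (.inr hγ))⟩
  | adj _ _ ih₁ ih₂ =>
    obtain ⟨F₁, hs₁, hf₁, h₁⟩ := ih₁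
    obtain ⟨F₂, hs₂, hf₂, h₂⟩ := ih₂
    exact ⟨F₁ ∪ F₂, Set.union_subset hs₁ hs₂, hf₁.union hf₂, fun v hv =>
      meet_ne_bot.2 ⟨h₁ v fun γ hγ => hv γ (.inl hγ), h₂ v fun γ hγ => hv γ (.inr hγ)⟩⟩

theorem SchematicExtension.mono {Ax G H : Set Formula} {φ : Formula} (hGH : G ⊆ H)
    (h : SchematicExtension Ax G φ) : SchematicExtension Ax H φ := by
  induction h with
  | hyp h => exact .hyp (hGH h)
  | axR h => exact .axR h
  | schema σ h => exact .schema σ h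
  | mp _ _ ih₁ ih₂ => exact .mp ih₁ ih₂
  | adj _ _ ih₁ ih₂ => exact .adj ih₁ ih₂

theorem exists_conjunction {F : Set Formula} (hF : F.Finite) :
    ∃ γ, logicC F γ ∧ ∀ v, val v γ ≠ bot → ∀ φ ∈ F, val v φ ≠ bot := by
  induction F, hF using Set.Finite.induction_on with
  -- Without constants, an identity axiom serves as the empty conjunction.
  | empty => exact ⟨_, .axR (.identity (.var 0)), by simp⟩
  | @insert φ F _ _ ih =>
    obtain ⟨γ, hγ, h⟩ := ih
    refine ⟨.and φ γ, .adj (.hyp (Set.mem_insert _ _)) (hγ.mono (Set.subset_insert _ _)), ?_⟩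
    rintro v hv ψ (rfl | hψ)
    · exact (meet_ne_bot.1 hv).1
    · exact h v (meet_ne_bot.1 hv).2 ψ hψ

/-- Completeness for finite sets of premises. -/
theorem logicC_of_entails {F : Set Formula} (hF : F.Finite) {α : Formula} (h : Entails F α) :
    logicC F α := by
  obtain ⟨γ, hγ, hγF⟩ := exists_conjunction hF
  -- The conjunct `α → α` is needed: `γ → α` itself may fail when both values are designated,
  -- whereas `y → y ≤ y` for every `y ≠ ⊥`.
  have hvalid : crystal.Valid (.imp (.and γ (.imp α α)) α) := by
    rw [crystal_valid_iff]
    intro v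
    have key : ∀ x y : Crystal, (x ≠ bot → y ≠ bot) →
        Crystal.imp (Crystal.meet x (Crystal.imp y y)) y ≠ bot := by decide
    exact key _ _ fun hx => h v (hγF v hx)
  have hax : logicC F (Formula.subst Formula.var (.imp (.and γ (.imp α α)) α)) :=
    .schema Formula.var (valid_generatedVariety_crystal.2 hvalid)
  rw [Formula.subst_var] at hax
  exact .mp hax (.adj hγ (.axR (.identity α)))

/-! ### Separating assignments and constructing interpolants. -/

theorem isHom_swap : IsHom crystal crystal swap where
  map_meet := by change ∀ x y : Crystal, swap (Crystal.meet x y) = Crystal.meet (swap x) (swap y); decide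
  map_join := by change ∀ x y : Crystal, swap (Crystal.join x y) = Crystal.join (swap x) (swap y); decide
  map_imp := by change ∀ x y : Crystal, swap (Crystal.imp x y) = Crystal.imp (swap x) (swap y); decide
  map_neg := by change ∀ x : Crystal, swap (Crystal.neg x) = Crystal.neg (swap x); decide

theorem val_swap (v : ℕ → Crystal) (φ : Formula) :
    val (fun p => swap (v p)) φ = swap (val v φ) :=
  (isHom_swap.map_eval v φ).symm

theorem val_const_a (φ : Formula) : val (fun _ => a) φ = a := by
  induction φ <;> simp_all [val, Alg.eval, crystal] <;> decide

theorem val_const_b (φ : Formula) : val (fun _ => b) φ = b := by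
  induction φ <;> simp_all [val, Alg.eval, crystal] <;> decide

/-- Assignments that no formula over `Z` separates can be made to agree on `Z`, by an
assignment that designates at least the same formulas. -/
theorem exists_agree_or_separate (Z : Set ℕ) (v w : ℕ → Crystal) :
    (∃ v' : ℕ → Crystal, (∀ φ, val v φ ≠ bot → val v' φ ≠ bot) ∧ ∀ p ∈ Z, w p = v' p) ∨
      ∃ δ : Formula, δ.vars ⊆ Z ∧ val v δ ≠ bot ∧ val w δ = bot := by
  by_contra! hcon
  obtain ⟨hagree, hsep⟩ := hcon
  -- The subalgebra of the square generated by the pairs `(v p, w p)` with `p ∈ Z`.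
  let S : Crystal → Crystal → Prop := fun x y =>
    ∃ δ : Formula, δ.vars ⊆ Z ∧ val v δ = x ∧ val w δ = y
  have hvar : ∀ p ∈ Z, S (v p) (w p) := fun p hp =>
    ⟨.var p, by simpa [Formula.vars] using hp, rfl, rfl⟩
  have hS := rel_cases (S := S)
    (by rintro _ _ _ _ ⟨δ, h, rfl, rfl⟩ ⟨δ', h', rfl, rfl⟩
        exact ⟨.and δ δ', Set.union_subset h h', rfl, rfl⟩)
    (by rintro _ _ _ _ ⟨δ, h, rfl, rfl⟩ ⟨δ', h', rfl, rfl⟩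
        exact ⟨.imp δ δ', Set.union_subset h h', rfl, rfl⟩)
    (by rintro _ _ ⟨δ, h, rfl, rfl⟩
        exact ⟨.neg δ, h, rfl, rfl⟩)
    (by rintro _ _ ⟨δ, h, rfl, rfl⟩ hx
        exact hsep δ h hx)
  have hswap : ∀ x : Crystal, x ≠ bot → swap x ≠ bot := by decide
  rcases hS with h | h | h | h
  · obtain ⟨p, hp, hne⟩ := hagree v fun _ => id
    exact hne (h _ _ (hvar p hp))
  · obtain ⟨p, hp, hne⟩ := hagree (fun p => swap (v p)) fun φ hφ => by
      rw [val_swap]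
      exact hswap _ hφ
    exact hne (h _ _ (hvar p hp))
  · obtain ⟨p, hp, hne⟩ := hagree (fun _ => a) fun φ _ => by
      rw [val_const_a]
      decide
    exact hne (h _ _ (hvar p hp))
  · obtain ⟨p, hp, hne⟩ := hagree (fun _ => b) fun φ _ => by
      rw [val_const_b]
      decide
    exact hne (h _ _ (hvar p hp))

/-- Finite sets of assignments that are pairwise separated by formulas over `Z` are separated by
a single formula over `Z`. -/
theorem exists_separating {Z : Set ℕ} (hZ : Z.Nonempty) {P N : Set (ℕ → Crystal)}
    (hP : P.Finite) (hN : N.Finite) (hne : P.Nonempty)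
    (h : ∀ v ∈ P, ∀ w ∈ N, ∃ δ : Formula, δ.vars ⊆ Z ∧ val v δ ≠ bot ∧ val w δ = bot) :
    ∃ δ : Formula, δ.vars ⊆ Z ∧ (∀ v ∈ P, val v δ ≠ bot) ∧ ∀ w ∈ N, val w δ = bot := by
  have hpoint : ∀ v ∈ P, ∃ δ : Formula, δ.vars ⊆ Z ∧ val v δ ≠ bot ∧ ∀ w ∈ N, val w δ = bot := by
    intro v hv
    replace h := h v hv
    induction N, hN using Set.Finite.induction_on with
    | empty =>
      obtain ⟨p, hp⟩ := hZ
      exact ⟨.imp (.var p) (.var p), by simpa [Formula.vars] using hp, imp_self_ne_bot _, by simp⟩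
    | @insert w N _ _ ih =>
      obtain ⟨δ, hδ, hvδ, hN⟩ := ih fun w hw => h w (.inr hw)
      obtain ⟨ε, hε, hvε, hw⟩ := h w (.inl rfl)
      refine ⟨.and δ ε, Set.union_subset hδ hε, meet_ne_bot.2 ⟨hvδ, hvε⟩, ?_⟩
      rintro u hu
      by_contra hbot
      rcases hu with rfl | hu
      · exact (meet_ne_bot.1 hbot).2 hw
      · exact (meet_ne_bot.1 hbot).1 (hN u hu)
  obtain ⟨v₀, hv₀⟩ := hne
  obtain ⟨δ₀, hδ₀, -, hN₀⟩ := hpoint v₀ hv₀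
  clear h hv₀
  induction P, hP using Set.Finite.induction_on with
  | empty => exact ⟨δ₀, hδ₀, by simp, hN₀⟩
  | @insert v P _ _ ih =>
    obtain ⟨δ, hδ, hPδ, hNδ⟩ := ih fun v hv => hpoint v (.inr hv)
    obtain ⟨ε, hε, hvε, hNε⟩ := hpoint v (.inl rfl)
    refine ⟨.or δ ε, Set.union_subset hδ hε, ?_, ?_⟩
    · rintro u (rfl | hu)
      · exact join_ne_bot.2 (.inr hvε)
      · exact join_ne_bot.2 (.inl (hPδ u hu))
    · intro w hw
      by_contra hbot
      rcases join_ne_bot.1 hbot with h | h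
      · exact h (hNδ w hw)
      · exact h (hNε w hw)

/-- Semantic form of the Maehara interpolation property, with the interpolant over a finite
nonempty set `Z` of variables containing the common ones. -/
theorem Entails.exists_interpolant {S G : Set Formula} {α : Formula} {Z : Set ℕ}
    (hfin : Z.Finite) (hZ : Z.Nonempty) (hsub : varsSet (S ∪ {α}) ∩ varsSet G ⊆ Z)
    (h : Entails (S ∪ G) α) :
    ∃ δ : Formula, δ.vars ⊆ Z ∧ Entails G δ ∧ Entails (S ∪ {δ}) α := by
  classical
  -- Resetting variables outside `Z` leaves finitely many assignments without changing values of
  -- formulas over `Z`.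
  let r : (ℕ → Crystal) → ℕ → Crystal := fun v p => if p ∈ Z then v p else a
  have hr : ∀ v (δ : Formula), δ.vars ⊆ Z → val (r v) δ = val v δ := fun v δ hδ =>
    crystal.eval_congr fun p hp => if_pos (hδ hp)
  have hrange : (Set.range r).Finite := by
    have := hfin.to_subtype
    refine (Set.finite_range fun (u : Z → Crystal) p => if hp : p ∈ Z then u ⟨p, hp⟩ else a).subset
      ?_
    rintro _ ⟨v, rfl⟩
    exact ⟨fun p => v p, by ext p; simp [r]⟩
  obtain ⟨δ, hδ, hP, hN⟩ := exists_separating (Z := Z) hZ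
    (P := r '' {v | ∀ γ ∈ G, val v γ ≠ bot})
    (N := r '' {w | (∀ σ ∈ S, val w σ ≠ bot) ∧ val w α = bot})
    (hrange.subset (Set.image_subset_range _ _)) (hrange.subset (Set.image_subset_range _ _))
    (Set.Nonempty.image _ ⟨fun _ => a, fun γ _ => by rw [val_const_a]; decide⟩) (by
      rintro _ ⟨v, hv, rfl⟩ _ ⟨w, ⟨hwS, hwα⟩, rfl⟩
      rcases exists_agree_or_separate Z v w with ⟨v', hv', hagree⟩ | ⟨δ, hδ, h₁, h₂⟩
      · exfalso
        -- Common variables lie in `Z`, where `v'` and `w` agree, so `g` satisfies `S` and `G` but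
        -- refutes `α`.
        let g : ℕ → Crystal := fun p => if p ∈ varsSet G then v' p else w p
        have hgw : ∀ φ ∈ S ∪ {α}, val g φ = val w φ := fun φ hφ =>
          crystal.eval_congr fun p hp => by
            by_cases hpG : p ∈ varsSet G
            · rw [hagree p (hsub ⟨⟨φ, hφ, hp⟩, hpG⟩)]
              exact if_pos hpG
            · exact if_neg hpG
        have hgv : ∀ γ ∈ G, val g γ = val v' γ := fun γ hγ =>
          crystal.eval_congr fun p hp => if_pos ⟨γ, hγ, hp⟩
        refine h g ?_ ((hgw α (.inr rfl)).trans hwα)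
        rintro φ (hφ | hφ)
        · rw [hgw φ (.inl hφ)]
          exact hwS φ hφ
        · rw [hgv φ hφ]
          exact hv' φ (hv φ hφ)
      · exact ⟨δ, hδ, by rwa [hr v δ hδ], by rwa [hr w δ hδ]⟩)
  refine ⟨δ, hδ, fun v hv => ?_, fun w hw hα => ?_⟩
  · rw [← hr v δ hδ]
    exact hP _ ⟨v, hv, rfl⟩
  · refine hw δ (.inr rfl) ?_
    rw [← hr w δ hδ]
    exact hN _ ⟨w, ⟨fun σ hσ => hw σ (.inl hσ), hα⟩, rfl⟩

/-! ### Variable sharing and interpolation for the logic. -/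

theorem Formula.finite_vars (φ : Formula) : φ.vars.Finite := by
  induction φ with
  | var p => exact Set.finite_singleton p
  | and _ _ ih₁ ih₂ | or _ _ ih₁ ih₂ | imp _ _ ih₁ ih₂ => exact ih₁.union ih₂
  | neg _ ih => exact ih

theorem finite_varsSet {F : Set Formula} (hF : F.Finite) : (varsSet F).Finite := by
  refine (hF.biUnion fun φ _ => φ.finite_vars).subset ?_
  rintro p ⟨φ, hφ, hp⟩
  exact Set.mem_biUnion hφ hp

theorem varsSet_mono {F G : Set Formula} (h : F ⊆ G) : varsSet F ⊆ varsSet G :=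
  fun _ ⟨φ, hφ, hp⟩ => ⟨φ, h hφ, hp⟩

theorem variableSharing_logicC : VariableSharing logicC := by
  classical
  intro α β h
  by_contra hdisj
  obtain ⟨F, hF, -, hent⟩ := exists_finite_entails h
  let v : ℕ → Crystal := fun p => if p ∈ α.vars then a else b
  have hα : val v α = a :=
    (crystal.eval_congr fun p hp => if_pos hp).trans (val_const_a α)
  have hβ : val v β = b :=
    (crystal.eval_congr fun p hp => if_neg fun hp' => hdisj ⟨p, hp', hp⟩).trans (val_const_b β)
  refine hent v (fun γ hγ => (hF hγ).elim) ?_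
  change Crystal.imp (val v α) (val v β) = bot
  rw [hα, hβ]
  rfl

theorem maeharaInterpolation_logicC : MaeharaInterpolation logicC := by
  rintro S G α ⟨p, hp⟩ h
  obtain ⟨F, hFsub, hF, hent⟩ := exists_finite_entails h
  have hSub : varsSet (F ∩ S ∪ {α}) ⊆ varsSet (S ∪ {α}) :=
    varsSet_mono (Set.union_subset_union_left _ Set.inter_subset_right)
  have hGub : varsSet (F ∩ G) ⊆ varsSet G := varsSet_mono Set.inter_subset_right
  obtain ⟨δ, hδ, hG, hS⟩ := Entails.exists_interpolant (S := F ∩ S) (G := F ∩ G) (α := α)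
    -- The finitely many premises used may share no variable; the given common variable `p` keeps
    -- `Z` nonempty.
    (Z := insert p (varsSet (F ∩ S ∪ {α}) ∩ varsSet (F ∩ G)))
    (((finite_varsSet (hF.inter_of_left G)).inter_of_right _).insert p)
    (Set.insert_nonempty _ _) (Set.subset_insert _ _)
    (by rwa [← Set.inter_union_distrib_left, Set.inter_eq_left.2 hFsub])
  refine ⟨δ, hδ.trans (Set.insert_subset hp (Set.inter_subset_inter hSub hGub)), ?_, ?_⟩
  · exact (logicC_of_entails (hF.inter_of_left G) hG).mono Set.inter_subset_right
  · exact (logicC_of_entails ((hF.inter_of_left S).union (Set.finite_singleton δ)) hS).mono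
      (Set.union_subset_union_left _ Set.inter_subset_right)

theorem MaeharaInterpolation.deductiveInterpolation {L : Set Formula → Formula → Prop}
    (h : MaeharaInterpolation L) : DeductiveInterpolation L := by
  intro G α hne hL
  have hvars : varsSet (∅ ∪ {α}) = α.vars := by
    ext p
    simp [varsSet]
  have := h ∅ G α
  rw [hvars, Set.empty_union] at this
  simpa only [Set.empty_union] using this hne hL

end RelevantLogic

theorem mainTheorem1 :
    RelevantLogic.VariableSharing RelevantLogic.logicC ∧
      RelevantLogic.MaeharaInterpolation RelevantLogic.logicC ∧
        RelevantLogic.DeductiveInterpolation RelevantLogic.logicC :=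
  ⟨RelevantLogic.variableSharing_logicC, RelevantLogic.maeharaInterpolation_logicC,
    RelevantLogic.maeharaInterpolation_logicC.deductiveInterpolation⟩
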